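/- Let $\mathcal N=\{1,\dots,n\}$ be a finite set of products and let $\mathcal S$ be any collection of nonempty subsets of $\mathcal N$ (assortments). A marginal distribution model (MDM) consists of deterministic utilities $\nu_1,\dots,\nu_n\in\mathbb R$ and of marginal laws $F_1,\dots,F_n$ on $\mathbb R$, each absolutely continuous, with finite first absolute moment, and with a distribution function that is strictly increasing on its support. Let $\Theta$ be the set of all joint laws of $(\tilde\epsilon_1,\dots,\tilde\epsilon_n)$ with these marginals. For an assortment $S$, the choice probabilities of the MDM are $$p_{i,S}=\mathbb P_{\tilde\epsilon\sim\theta^*}\Big(i=\arg\max_{j\in S}\{\nu_j+\tilde\epsilon_j\}\Big),\qquad i\in S,$$ where $\theta^*\in\Theta$ attains $\sup_{\theta\in\Theta}\mathbb E_{\tilde\epsilon\sim\theta}\big[\max_{i\in S}\{\nu_i+\tilde\epsilon_i\}\big]$. Let $\Delta_S=\{(x_{i,S})_{i\in S}: x_{i,S}\ge 0,\ \sum_{i\in S}x_{i,S}=1\}$, and let $\mathcal P_{\mathrm{MDM}}(\mathcal S)\subseteq\prod_{S\in\mathcal S}\Delta_S$ be the set of all collections $(p_{i,S}: i\in S,\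 S\in\mathcal S)$ for which there is a single MDM that yields $(p_{i,S})_{i\in S}$ as its choice probabilities for every $S\in\mathcal S$. Then, for every such collection $\mathcal S$, the set $\mathcal P_{\mathrm{MDM}}(\mathcal S)$ has positive measure: $\mu\big(\mathcal P_{\mathrm{MDM}}(\mathcal S)\big)>0$, where $\mu$ is the Lebesgue measure on $\prod_{S\in\mathcal S}\Delta_S$, i.e. the product of the $(|S|-1)$-dimensional Lebesgue measures on the simplices $\Delta_S$ (a unit point mass if $|S|=1$). More precisely, $\mathcal P_{\mathrm{MDM}}(\mathcal S)$ contains a measurable set of positive $\mu$-measure. -/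

import Mathlib

open MeasureTheory ProbabilityTheory

/-- A marginal distribution model on the products `Fin n`: deterministic utilities `ν i`, together
with the prescribed laws of the random terms `ε i`.  Each law is an absolutely continuous
probability measure on `ℝ` with finite first absolute moment, whose distribution function is
strictly increasing on its support. -/
structure MDM (n : ℕ) where
  /-- the deterministic utilities -/
  ν : Fin n → ℝ
  /-- the marginal laws of the random terms -/
  law : Fin n → Measure ℝ
  isProbabilityMeasure : ∀ i, IsProbabilityMeasure (law i)
  absolutelyContinuous : ∀ i, law i ≪ volume
  strictMonoOn_cdf : ∀ i, StrictMonoOn (cdf (law i)) (law i).support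
  integrable_abs : ∀ i, Integrable (fun x : ℝ => |x|) (law i)

namespace MDM

variable {n : ℕ} (M : MDM n)

/-- The joint distributions of `(ε 1, …, ε n)` with the prescribed marginal laws (no assumption on
the dependence). -/
def couplings : Set (Measure (Fin n → ℝ)) :=
  {θ | IsProbabilityMeasure θ ∧ ∀ i, θ.map (fun ε => ε i) = M.law i}

/-- The expected maximal utility over the assortment `S` under the joint law `θ`.
(For `θ ∈ M.couplings` the integrand is integrable, as all `ε i` are.) -/
noncomputable def expectedMaxUtility (S : Finset (Fin n)) (hS : S.Nonempty)
    (θ : Measure (Fin n → ℝ)) : ℝ :=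
  ∫ ε, S.sup' hS (fun i => M.ν i + ε i) ∂θ

/-- `θ` is a joint law with the prescribed marginals which attains the maximal expected utility
over the assortment `S`. -/
def IsOptimal (S : Finset (Fin n)) (hS : S.Nonempty) (θ : Measure (Fin n → ℝ)) : Prop :=
  θ ∈ M.couplings ∧
    ∀ θ' ∈ M.couplings, M.expectedMaxUtility S hS θ' ≤ M.expectedMaxUtility S hS θ

/-- The probability under `θ` that `i` is the (unique) utility maximizing product of `S`. -/
noncomputable def choiceProb (S : Finset (Fin n)) (θ : Measure (Fin n → ℝ)) (i : Fin n) : ℝ :=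
  θ.real {ε | ∀ j ∈ S, j ≠ i → M.ν j + ε j < M.ν i + ε i}

end MDM

/-- Vectors `(x_{i,S} : i ∈ S, S ∈ 𝒮)`. -/
abbrev ChoiceData {n : ℕ} (𝒮 : Finset (Finset (Fin n))) : Type :=
  (S : {S // S ∈ 𝒮}) → EuclideanSpace ℝ {i // i ∈ S.1}

/-- The probability simplex `Δ_S`. -/
def probSimplex {n : ℕ} (S : Finset (Fin n)) : Set (EuclideanSpace ℝ {i // i ∈ S}) :=
  {x | (∀ i, 0 ≤ x i) ∧ ∑ i, x i = 1}

/-- The choice probability collections over `𝒮` which are represented by some marginal distribution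
model: one and the same model has to yield the choice probabilities of all assortments `S ∈ 𝒮`,
those of `S` being evaluated under a joint law that is optimal for `S`. -/
def mdmRepresentable {n : ℕ} (𝒮 : Finset (Finset (Fin n))) (h𝒮 : ∀ S ∈ 𝒮, S.Nonempty) :
    Set (ChoiceData 𝒮) :=
  {p | (∀ S, p S ∈ probSimplex S.1) ∧
    ∃ M : MDM n, ∀ S : {S // S ∈ 𝒮}, ∃ θ : Measure (Fin n → ℝ),
      M.IsOptimal S.1 (h𝒮 S.1 S.2) θ ∧ ∀ i : {i // i ∈ S.1}, p S i = M.choiceProb S.1 θ i.1}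

/-- The space of vectors with coordinate sum `0`, i.e. the direction of the affine hull of `Δ_S`. -/
def sumZero {n : ℕ} (S : Finset (Fin n)) : Submodule ℝ (EuclideanSpace ℝ {i // i ∈ S}) where
  carrier := {v | ∑ i, v i = 0}
  zero_mem' := by simp
  add_mem' := by
    intro a b ha hb
    simp only [Set.mem_ofPred_eq, PiLp.add_apply, Finset.sum_add_distrib] at *
    rw [ha, hb, add_zero]
  smul_mem' := by
    intro c a ha
    simp only [Set.mem_ofPred_eq, PiLp.smul_apply, smul_eq_mul, ← Finset.mul_sum] at *
    rw [ha, mul_zero]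

/-- The barycenter of `Δ_S`. -/
noncomputable def barycenter {n : ℕ} (S : Finset (Fin n)) : EuclideanSpace ℝ {i // i ∈ S} :=
  WithLp.toLp 2 (fun _ => (S.card : ℝ)⁻¹)

/-- The (`|S| - 1`-dimensional) Lebesgue measure on `Δ_S`: the Lebesgue measure of the Euclidean
space `sumZero S` (the Haar measure which gives the unit cube of an orthonormal basis measure `1`),
carried over to the hyperplane `∑ i, x i = 1` by a translation and restricted to `Δ_S`. If `S` has
one element, this is the unit mass at the only point of `Δ_S`. -/
noncomputable def simplexMeasure {n : ℕ} (S : Finset (Fin n)) :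
    Measure (EuclideanSpace ℝ {i // i ∈ S}) :=
  ((stdOrthonormalBasis ℝ (sumZero S)).toBasis.addHaar.map
    (fun v : sumZero S => barycenter S + v.1)).restrict (probSimplex S)

/-- The Lebesgue measure on the product of simplices `∏_{S ∈ 𝒮} Δ_S`. -/
noncomputable def simplexProdMeasure {n : ℕ} (𝒮 : Finset (Finset (Fin n))) :
    Measure (ChoiceData 𝒮) :=
  Measure.pi (fun S : {S // S ∈ 𝒮} => simplexMeasure S.1)

/-!
If the levels `r S` satisfy `r S < r T ↔ p_{i,T} < p_{i,S}` for all `i ∈ S ∩ T`, then positive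
choice data `p` are represented by an MDM: take `ν = 0` and a law of `ε i` whose tail at each level
`r S` is `p_{i,S}`. The tails at `r S` then add up to `1` over `S`, so that the laws can be coupled
with exactly one `ε i`, `i ∈ S`, reaching `r S`; by the duality bound
`max_{i ∈ S} u_i ≤ t + ∑_{i ∈ S} (u_i - t)⁺`, an equality when exactly one `u_i` reaches `t`, such a
coupling is optimal.

For injective `r` the displayed condition is open in `p`. A point in the interior of the product of
simplices which satisfies it is given by the multinomial logit model with weights `w i`, for which
`r S = ∑_{i ∈ S} w i`; the weights `2 ^ i` make `r` injective.
-/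

/-! ### Laws on the line with prescribed tails -/

section Tails

open Set Filter

/-- An absolutely continuous measure on `ℝ` which is carried by `[a, b]` and charges all
subintervals of `[a, b]`. For a probability measure this yields the regularity that an `MDM`
requires of its laws; it is stated for arbitrary measures so that a law can be glued together from
pieces on adjacent intervals. -/
structure IsSpreadOn (μ : Measure ℝ) (a b : ℝ) : Prop where
  absolutelyContinuous : μ ≪ volume
  measure_compl_Icc : μ (Icc a b)ᶜ = 0
  measure_Ioo_pos : ∀ ⦃u v⦄, a ≤ u → u < v → v ≤ b → 0 < μ (Ioo u v)

lemma isSpreadOn_smul_restrict_volume {c : ENNReal} (hc : c ≠ 0) (a b : ℝ) :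
    IsSpreadOn (c • volume.restrict (Icc a b)) a b where
  absolutelyContinuous :=
    Measure.smul_absolutelyContinuous.trans Measure.absolutelyContinuous_restrict
  measure_compl_Icc := by simp [Measure.restrict_apply measurableSet_Icc.compl]
  measure_Ioo_pos u v hu huv hv := by
    have hsub : Ioo u v ⊆ Icc a b := fun x hx => ⟨hu.trans hx.1.le, hx.2.le.trans hv⟩
    rw [Measure.smul_apply, smul_eq_mul, Measure.restrict_apply measurableSet_Ioo,
      inter_eq_left.2 hsub, Real.volume_Ioo]
    exact ENNReal.mul_pos hc (by simpa using huv)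

lemma exists_isSpreadOn_measure_univ_eq {a b m : ℝ} (hab : a < b) (hm : 0 < m) :
    ∃ μ, IsSpreadOn μ a b ∧ μ univ = ENNReal.ofReal m := by
  have hslope : 0 < m / (b - a) := div_pos hm (sub_pos.2 hab)
  refine ⟨ENNReal.ofReal (m / (b - a)) • volume.restrict (Icc a b),
    isSpreadOn_smul_restrict_volume (by simpa using hslope) a b, ?_⟩
  rw [Measure.smul_apply, smul_eq_mul, Measure.restrict_apply_univ, Real.volume_Icc,
    ← ENNReal.ofReal_mul hslope.le, div_mul_cancel₀ _ (sub_pos.2 hab).ne']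

namespace IsSpreadOn

variable {μ ν : Measure ℝ} {a b c : ℝ}

lemma add (hμ : IsSpreadOn μ a b) (hν : IsSpreadOn ν b c) (hab : a ≤ b) (hbc : b ≤ c) :
    IsSpreadOn (μ + ν) a c where
  absolutelyContinuous := hμ.absolutelyContinuous.add_left hν.absolutelyContinuous
  measure_compl_Icc := by
    rw [Measure.add_apply, add_eq_zero]
    exact ⟨measure_mono_null (compl_subset_compl.2 (Icc_subset_Icc_right hbc)) hμ.measure_compl_Icc,
      measure_mono_null (compl_subset_compl.2 (Icc_subset_Icc_left hab)) hν.measure_compl_Icc⟩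
  measure_Ioo_pos u v hu huv hv := by
    rw [Measure.add_apply]
    rcases lt_or_ge u b with hub | hbu
    · have hpos := hμ.measure_Ioo_pos hu (lt_min huv hub) (min_le_right v b)
      exact (hpos.trans_le (measure_mono (Ioo_subset_Ioo_right (min_le_left v b)))).trans_le
        le_self_add
    · exact (hν.measure_Ioo_pos hbu huv hv).trans_le le_add_self

lemma measure_Ici_of_le_left (hμ : IsSpreadOn μ a b) {y : ℝ} (hy : y ≤ a) :
    μ (Ici y) = μ univ :=
  measure_eq_measure_of_null_sdiff (subset_univ _) <|
    measure_mono_null (t := (Icc a b)ᶜ) (fun _ hz hz' => hz.2 (hy.trans hz'.1))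
      hμ.measure_compl_Icc

lemma measure_Ici_right (hμ : IsSpreadOn μ a b) : μ (Ici b) = 0 := by
  rw [← Ioi_union_left, measure_union_null_iff]
  have hsub : Ioi b ⊆ (Icc a b)ᶜ := fun _ hz hz' => not_le.2 hz hz'.2
  exact ⟨measure_mono_null hsub hμ.measure_compl_Icc, hμ.absolutelyContinuous (by simp)⟩

lemma ae_mem_Icc (hμ : IsSpreadOn μ a b) : ∀ᵐ x ∂μ, x ∈ Icc a b :=
  mem_ae_iff.2 hμ.measure_compl_Icc

lemma strictMonoOn_cdf [IsProbabilityMeasure μ] (hμ : IsSpreadOn μ a b) :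
    StrictMonoOn (cdf μ) μ.support := by
  have hsupp : μ.support ⊆ Icc a b :=
    Measure.support_subset_of_isClosed isClosed_Icc hμ.ae_mem_Icc
  intro u hu v hv huv
  rw [cdf_eq_real, cdf_eq_real, ← Iic_union_Ioc_eq_Iic huv.le,
    measureReal_union (Iic_disjoint_Ioc le_rfl) measurableSet_Ioc, lt_add_iff_pos_right]
  have hpos : 0 < μ (Ioc u v) :=
    (hμ.measure_Ioo_pos (hsupp hu).1 huv (hsupp hv).2).trans_le (measure_mono Ioo_subset_Ioc_self)
  exact ENNReal.toReal_pos hpos.ne' (measure_ne_top _ _)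

lemma integrable_abs [IsFiniteMeasure μ] (hμ : IsSpreadOn μ a b) :
    Integrable (fun x : ℝ => |x|) μ := by
  refine Integrable.of_bound (by fun_prop) (max |a| |b|) ?_
  filter_upwards [hμ.ae_mem_Icc] with x hx
  simpa using abs_le_max_abs_abs hx.1 hx.2

end IsSpreadOn

lemma exists_isSpreadOn_measure_Ici_eq {Q : ℝ → ℝ} {a m : ℝ} (s : Finset ℝ)
    (hQ : StrictAntiOn Q s) :
    ∀ b c : ℝ, a < b → c < m → (∀ x ∈ s, x ∈ Ioo a b ∧ Q x ∈ Ioo c m) →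
      ∃ μ, IsSpreadOn μ a b ∧ μ univ = ENNReal.ofReal (m - c) ∧
        ∀ x ∈ s, μ (Ici x) = ENNReal.ofReal (Q x - c) := by
  induction s using Finset.induction_on_max with
  | empty =>
    intro b c hab hcm _
    obtain ⟨μ, hμ, hmass⟩ := exists_isSpreadOn_measure_univ_eq hab (sub_pos.2 hcm)
    exact ⟨μ, hμ, hmass, by simp⟩
  | insert k s hk ih =>
    intro b c _ _ hs
    obtain ⟨⟨hak, hkb⟩, hck, hkm⟩ := hs k (Finset.mem_insert_self k s)
    have hQk : ∀ x ∈ s, Q k < Q x := fun x hx => hQ (by simp [hx]) (by simp) (hk x hx)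
    obtain ⟨ν, hν, hνmass⟩ := exists_isSpreadOn_measure_univ_eq hkb (sub_pos.2 hck)
    -- Subtracting the mass `Q k - c` carried by `[k, b]` leaves a tail interpolation on `[a, k]`.
    obtain ⟨μ, hμ, hμmass, hμtail⟩ := ih (hQ.mono (by simp)) k (Q k) hak hkm fun x hx =>
      have hx' := hs x (Finset.mem_insert_of_mem hx)
      ⟨⟨hx'.1.1, hk x hx⟩, hQk x hx, hx'.2.2⟩
    have hglue : ∀ y, Q k ≤ y → ENNReal.ofReal (y - Q k) + ENNReal.ofReal (Q k - c) =
        ENNReal.ofReal (y - c) := fun y hy => by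
      rw [← ENNReal.ofReal_add (sub_nonneg.2 hy) (sub_pos.2 hck).le, sub_add_sub_cancel]
    refine ⟨μ + ν, hμ.add hν hak.le hkb.le, ?_, fun x hx => ?_⟩
    · rw [Measure.add_apply, hμmass, hνmass, hglue m hkm.le]
    · rw [Measure.add_apply]
      rcases Finset.mem_insert.1 hx with rfl | hx
      · rw [hμ.measure_Ici_right, hν.measure_Ici_of_le_left le_rfl, hνmass, zero_add]
      · rw [hμtail x hx, hν.measure_Ici_of_le_left (hk x hx).le, hνmass, hglue _ (hQk x hx).le]

lemma exists_forall_lt_iff_lt {ι α β : Type*} [Finite ι] [LinearOrder α] [NoMinOrder α] [Nonempty α]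
    [LinearOrder β] {x : ι → α} {q : ι → β} (h : ∀ i j, q j < q i → x i < x j) (m : β) :
    ∃ a, ∀ i, a < x i ↔ q i < m := by
  rcases isEmpty_or_nonempty {i // m ≤ q i} with hempty | hne
  · obtain ⟨a, ha⟩ := (eventually_all.2 fun i => eventually_lt_atBot (x i)).exists
    exact ⟨a, fun i => iff_of_true (ha i) (not_le.1 fun hi => hempty.false ⟨i, hi⟩)⟩
  · obtain ⟨⟨k, hk⟩, hmax⟩ := Finite.exists_max fun i : {i // m ≤ q i} => x i
    refine ⟨x k, fun i => ⟨fun hki => ?_, fun hi => h k i (hi.trans_le hk)⟩⟩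
    exact not_le.1 fun hi => (hmax ⟨i, hi⟩).not_gt hki

lemma exists_isSpreadOn_isProbabilityMeasure_measure_Ici_eq {ι : Type*} [Finite ι] {x q : ι → ℝ}
    (h : ∀ i j, x i < x j ↔ q j < q i) (hq : ∀ i, q i ∈ Ioc 0 1) :
    ∃ μ a b, IsSpreadOn μ a b ∧ IsProbabilityMeasure μ ∧
      ∀ i, μ (Ici (x i)) = ENNReal.ofReal (q i) := by
  classical
  have := Fintype.ofFinite ι
  obtain ⟨a, ha⟩ := exists_forall_lt_iff_lt (fun i j => (h i j).2) 1
  obtain ⟨b, hab, hb⟩ := ((eventually_gt_atTop a).and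
    (eventually_all.2 fun i => eventually_gt_atTop (x i))).exists
  set Q : ℝ → ℝ := Function.extend x q 0
  have hQ : ∀ i, Q (x i) = q i := Function.FactorsThrough.extend_apply (fun i j hij =>
    le_antisymm (not_lt.1 fun hlt => hij.not_lt ((h i j).2 hlt))
      (not_lt.1 fun hlt => hij.not_gt ((h j i).2 hlt))) 0
  obtain ⟨μ, hμ, hmass, htail⟩ := exists_isSpreadOn_measure_Ici_eq (Q := Q)
    (({i | q i < 1} : Finset ι).image x) (by
      simp only [StrictAntiOn, Finset.coe_image, forall_mem_image, hQ]
      exact fun i _ j _ => (h i j).1) b 0 hab one_pos (by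
      simp only [Finset.forall_mem_image, Finset.mem_filter_univ, hQ]
      exact fun i hi => ⟨⟨(ha i).2 hi, hb i⟩, (hq i).1, hi⟩)
  rw [sub_zero, ENNReal.ofReal_one] at hmass
  refine ⟨μ, a, b, hμ, ⟨hmass⟩, fun i => ?_⟩
  rcases (hq i).2.lt_or_eq with hlt | heq
  · rw [htail (x i) (Finset.mem_image_of_mem x (by simpa using hlt)), hQ, sub_zero]
  · rw [hμ.measure_Ici_of_le_left (not_lt.1 fun hi => ((ha i).1 hi).ne heq), hmass, heq,
      ENNReal.ofReal_one]

end Tails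

/-! ### Coupling laws so that exactly one event occurs -/

section ExclusiveCoupling

variable {ι : Type*} [Fintype ι] [DecidableEq ι] {α : ι → Type*} [∀ i, MeasurableSpace (α i)]
  (μ : ∀ i, Measure (α i)) (A : ∀ i, Set (α i))

/-- The joint law of independent random variables with laws `μ i`, conditioned on the event `A k`
occurring for the `k`-th variable and no `A i`, `i ≠ k`, occurring for the others. -/
noncomputable def soleEventLaw (k : ι) : Measure (∀ i, α i) :=
  Measure.pi fun i => (μ i)[|if i = k then A i else (A i)ᶜ]

/-- The mixture of the laws `soleEventLaw μ A k` with weights `μ k (A k)`. If these weights sum up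
to `1`, it is a coupling of the laws `μ i` under which almost surely exactly one of the events `A i`
occurs. -/
noncomputable def exclusiveCoupling : Measure (∀ i, α i) :=
  ∑ k, μ k (A k) • soleEventLaw μ A k

variable {μ A} [∀ i, IsProbabilityMeasure (μ i)]

lemma sum_erase_measure_eq_measure_compl (hA : ∀ i, MeasurableSet (A i))
    (hsum : ∑ i, μ i (A i) = 1) (i : ι) :
    ∑ k ∈ Finset.univ.erase i, μ k (A k) = μ i (A i)ᶜ := by
  rw [← ENNReal.add_right_inj (measure_ne_top (μ i) (A i)),
    Finset.add_sum_erase _ (fun k => μ k (A k)) (Finset.mem_univ i), hsum,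
    measure_add_measure_compl (hA i), measure_univ]

lemma isProbabilityMeasure_cond_ite (hA : ∀ i, MeasurableSet (A i)) (hsum : ∑ i, μ i (A i) = 1)
    {k : ι} (hk : μ k (A k) ≠ 0) (i : ι) :
    IsProbabilityMeasure (μ i)[|if i = k then A i else (A i)ᶜ] := by
  apply cond_isProbabilityMeasure
  split_ifs with hik
  · exact hik ▸ hk
  · rw [← sum_erase_measure_eq_measure_compl hA hsum i]
    exact fun h => hk (Finset.sum_eq_zero_iff.1 h k (by simp [Ne.symm hik]))

lemma measurePreserving_eval_soleEventLaw (hA : ∀ i, MeasurableSet (A i))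
    (hsum : ∑ i, μ i (A i) = 1) {k : ι} (hk : μ k (A k) ≠ 0) (i : ι) :
    MeasurePreserving (Function.eval i) (soleEventLaw μ A k)
      (μ i)[|if i = k then A i else (A i)ᶜ] :=
  have := isProbabilityMeasure_cond_ite hA hsum hk
  measurePreserving_eval _ i

lemma ae_soleEventLaw_mem_iff (hA : ∀ i, MeasurableSet (A i)) (hsum : ∑ i, μ i (A i) = 1)
    {k : ι} (hk : μ k (A k) ≠ 0) :
    ∀ᵐ x ∂soleEventLaw μ A k, ∀ i, x i ∈ A i ↔ i = k := by
  refine ae_all_iff.2 fun i => ?_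
  have hmeas : MeasurableSet (if i = k then A i else (A i)ᶜ) := by
    split_ifs
    exacts [hA i, (hA i).compl]
  filter_upwards [(measurePreserving_eval_soleEventLaw hA hsum hk i).quasiMeasurePreserving.ae
    (ae_cond_mem hmeas)] with x hx
  split_ifs at hx with hik
  exacts [iff_of_true hx hik, iff_of_false hx hik]

theorem map_eval_exclusiveCoupling (hA : ∀ i, MeasurableSet (A i)) (hsum : ∑ i, μ i (A i) = 1)
    (i : ι) : (exclusiveCoupling μ A).map (Function.eval i) = μ i := by
  ext B hB
  have hcomponent : ∀ k, μ k (A k) * soleEventLaw μ A k (Function.eval i ⁻¹' B) =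
      μ k (A k) * (μ i)[|if i = k then A i else (A i)ᶜ] B := fun k => by
    by_cases hk : μ k (A k) = 0
    · simp only [hk, zero_mul]
    · rw [(measurePreserving_eval_soleEventLaw hA hsum hk i).measure_preimage hB.nullMeasurableSet]
  have hothers : ∑ k ∈ Finset.univ.erase i, μ k (A k) * (μ i)[|if i = k then A i else (A i)ᶜ] B =
      μ i (A i)ᶜ * (μ i)[|(A i)ᶜ] B := by
    rw [← sum_erase_measure_eq_measure_compl hA hsum i, Finset.sum_mul]
    exact Finset.sum_congr rfl fun k hk => by rw [if_neg (Finset.ne_of_mem_erase hk).symm]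
  calc (exclusiveCoupling μ A).map (Function.eval i) B
      = ∑ k, μ k (A k) * (μ i)[|if i = k then A i else (A i)ᶜ] B := by
        simp only [Measure.map_apply (measurable_pi_apply i) hB, exclusiveCoupling,
          Measure.finsetSum_apply, Measure.smul_apply, smul_eq_mul, hcomponent]
    _ = μ i (A i) * (μ i)[|A i] B + μ i (A i)ᶜ * (μ i)[|(A i)ᶜ] B := by
        rw [← Finset.add_sum_erase _ _ (Finset.mem_univ i), if_pos rfl, hothers]
    _ = μ i B := by
        rw [mul_comm, mul_comm (μ i (A i)ᶜ), cond_add_cond_compl_eq (hA i)]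

lemma isProbabilityMeasure_exclusiveCoupling (hA : ∀ i, MeasurableSet (A i))
    (hsum : ∑ i, μ i (A i) = 1) : IsProbabilityMeasure (exclusiveCoupling μ A) := by
  obtain ⟨i, -, -⟩ := Finset.exists_ne_zero_of_sum_ne_zero (hsum.trans_ne one_ne_zero)
  have : IsProbabilityMeasure ((exclusiveCoupling μ A).map (Function.eval i)) := by
    rw [map_eval_exclusiveCoupling hA hsum i]
    infer_instance
  exact Measure.isProbabilityMeasure_of_map (Function.eval i)

theorem ae_exclusiveCoupling_existsUnique (hA : ∀ i, MeasurableSet (A i))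
    (hsum : ∑ i, μ i (A i) = 1) : ∀ᵐ x ∂exclusiveCoupling μ A, ∃! k, x k ∈ A k := by
  rw [exclusiveCoupling, ae_finsetSum_measure_iff]
  intro k _
  by_cases hk : μ k (A k) = 0
  · simp [hk]
  · refine Measure.ae_smul_measure ?_ _
    filter_upwards [ae_soleEventLaw_mem_iff hA hsum hk] with x hx
    exact ⟨k, (hx k).2 rfl, fun i => (hx i).1⟩

end ExclusiveCoupling

/-! ### Optimal joint laws -/

section Sup

variable {ι : Type*} {S : Finset ι}

lemma sup'_le_add_sum_max_sub_zero (hS : S.Nonempty) (u : ι → ℝ) (t : ℝ) :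
    S.sup' hS u ≤ t + ∑ i ∈ S, max (u i - t) 0 := by
  refine Finset.sup'_le _ _ fun i hi => ?_
  have hle : u i - t ≤ ∑ i ∈ S, max (u i - t) 0 := (le_max_left _ _).trans
    (Finset.single_le_sum (f := fun i => max (u i - t) 0) (fun _ _ => le_max_right _ _) hi)
  linarith

lemma sup'_eq_add_sum_max_sub_zero (hS : S.Nonempty) {u : ι → ℝ} {t : ℝ}
    (h : ∃! k, k ∈ S ∧ t ≤ u k) : S.sup' hS u = t + ∑ i ∈ S, max (u i - t) 0 := by
  obtain ⟨k, ⟨hkS, hk⟩, hunique⟩ := h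
  refine le_antisymm (sup'_le_add_sum_max_sub_zero hS u t) ?_
  have hbelow : ∀ j ∈ S, j ≠ k → max (u j - t) 0 = 0 := fun j hj hjk =>
    max_eq_right (sub_nonpos.2 (not_le.1 fun hle => hjk (hunique j ⟨hj, hle⟩)).le)
  rw [Finset.sum_eq_single_of_mem k hkS hbelow, max_eq_left (sub_nonneg.2 hk), add_sub_cancel]
  exact Finset.le_sup' u hkS

lemma integrable_sup' {Ω : Type*} [MeasurableSpace Ω] {θ : Measure Ω} (hS : S.Nonempty)
    {u : ι → Ω → ℝ} (hu : ∀ i ∈ S, Integrable (u i) θ) :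
    Integrable (fun ω => S.sup' hS fun i => u i ω) θ := by
  simpa only [← Finset.sup'_apply] using
    Finset.sup'_induction hS u (p := (Integrable · θ)) (fun _ hf _ hg => hf.sup hg) hu

end Sup

namespace MDM

variable {n : ℕ} (M : MDM n) {θ : Measure (Fin n → ℝ)} {S : Finset (Fin n)} {t : ℝ}

/-- The objective of the dual of the problem of maximizing the expected maximal utility over `S`:
its value at any level `t` bounds the expected maximal utility under all couplings. -/
noncomputable def dualValue (S : Finset (Fin n)) (t : ℝ) : ℝ :=
  t + ∑ i ∈ S, ∫ x, max (M.ν i + x - t) 0 ∂M.law i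

variable {M}

lemma integrable_utility (hθ : θ ∈ M.couplings) (i : Fin n) :
    Integrable (fun ε : Fin n → ℝ => M.ν i + ε i) θ := by
  have := hθ.1
  have hlaw : Integrable id (θ.map fun ε => ε i) := by
    rw [hθ.2 i]
    exact (integrable_norm_iff (by fun_prop)).1 (M.integrable_abs i)
  exact (integrable_const _).add (hlaw.comp_measurable (measurable_pi_apply i))

lemma integrable_excess (hθ : θ ∈ M.couplings) (t : ℝ) (i : Fin n) :
    Integrable (fun ε : Fin n → ℝ => max (M.ν i + ε i - t) 0) θ :=
  have := hθ.1
  ((integrable_utility hθ i).sub (integrable_const t)).pos_part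

lemma integrable_add_sum_excess (hθ : θ ∈ M.couplings) (S : Finset (Fin n)) (t : ℝ) :
    Integrable (fun ε : Fin n → ℝ => t + ∑ i ∈ S, max (M.ν i + ε i - t) 0) θ :=
  have := hθ.1
  (integrable_const t).add (integrable_finsetSum _ fun i _ => integrable_excess hθ t i)

lemma integral_add_sum_excess (hθ : θ ∈ M.couplings) (S : Finset (Fin n)) (t : ℝ) :
    ∫ ε, t + ∑ i ∈ S, max (M.ν i + ε i - t) 0 ∂θ = M.dualValue S t := by
  have := hθ.1
  have hexcess : ∀ i, ∫ ε, max (M.ν i + ε i - t) 0 ∂θ =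
      ∫ x, max (M.ν i + x - t) 0 ∂M.law i := fun i => by
    rw [← hθ.2 i, integral_map (measurable_pi_apply i).aemeasurable (by fun_prop)]
  rw [integral_add (integrable_const t)
      (integrable_finsetSum _ fun i _ => integrable_excess hθ t i),
    integral_finsetSum _ fun i _ => integrable_excess hθ t i]
  simp [dualValue, hexcess]

lemma expectedMaxUtility_le_dualValue (hθ : θ ∈ M.couplings) (hS : S.Nonempty) (t : ℝ) :
    M.expectedMaxUtility S hS θ ≤ M.dualValue S t := by
  rw [← integral_add_sum_excess hθ]
  exact integral_mono (integrable_sup' hS fun i _ => integrable_utility hθ i)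
    (integrable_add_sum_excess hθ S t) fun ε => sup'_le_add_sum_max_sub_zero hS _ t

lemma expectedMaxUtility_eq_dualValue (hθ : θ ∈ M.couplings) (hS : S.Nonempty)
    (h : ∀ᵐ ε ∂θ, ∃! k, k ∈ S ∧ t ≤ M.ν k + ε k) :
    M.expectedMaxUtility S hS θ = M.dualValue S t := by
  rw [← integral_add_sum_excess hθ]
  exact integral_congr_ae (h.mono fun ε hε => sup'_eq_add_sum_max_sub_zero hS hε)

theorem isOptimal_of_ae_existsUnique (hθ : θ ∈ M.couplings) (hS : S.Nonempty)
    (h : ∀ᵐ ε ∂θ, ∃! k, k ∈ S ∧ t ≤ M.ν k + ε k) : M.IsOptimal S hS θ :=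
  ⟨hθ, fun _ hθ' => (expectedMaxUtility_le_dualValue hθ' hS t).trans_eq
    (expectedMaxUtility_eq_dualValue hθ hS h).symm⟩

lemma choiceProb_eq_of_ae_existsUnique (hθ : θ ∈ M.couplings)
    (h : ∀ᵐ ε ∂θ, ∃! k, k ∈ S ∧ t ≤ M.ν k + ε k) {i : Fin n} (hi : i ∈ S) :
    M.choiceProb S θ i = (M.law i).real (Set.Ici (t - M.ν i)) := by
  have hwins : ∀ᵐ ε ∂θ, (∀ j ∈ S, j ≠ i → M.ν j + ε j < M.ν i + ε i) ↔ t - M.ν i ≤ ε i := by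
    filter_upwards [h] with ε ⟨k, ⟨hkS, hk⟩, hunique⟩
    have hbelow : ∀ j ∈ S, j ≠ k → M.ν j + ε j < t := fun j hj hjk =>
      not_le.1 fun hle => hjk (hunique j ⟨hj, hle⟩)
    rw [sub_le_iff_le_add']
    refine ⟨fun hwin => ?_, fun hti j hj hji => ?_⟩
    · by_contra hti
      have hki : k ≠ i := by
        rintro rfl
        exact hti hk
      exact hti (hk.trans (hwin k hkS hki).le)
    · obtain rfl := hunique i ⟨hi, hti⟩
      exact (hbelow j hj hji).trans_le hti
  rw [← hθ.2 i, map_measureReal_apply (measurable_pi_apply i) measurableSet_Ici]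
  exact measureReal_congr (hwins.mono fun ε hε => propext hε)

theorem exists_isOptimal_choiceProb_eq (M : MDM n) (hS : S.Nonempty)
    (hsum : ∑ i ∈ S, M.law i (Set.Ici (t - M.ν i)) = 1) :
    ∃ θ, M.IsOptimal S hS θ ∧
      ∀ i ∈ S, M.choiceProb S θ i = (M.law i).real (Set.Ici (t - M.ν i)) := by
  have := M.isProbabilityMeasure
  set A : Fin n → Set ℝ := fun i => if i ∈ S then Set.Ici (t - M.ν i) else ∅
  have hA : ∀ i, MeasurableSet (A i) := fun i => by
    simp only [A]
    split_ifs
    exacts [measurableSet_Ici, MeasurableSet.empty]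
  have hsumA : ∑ i, M.law i (A i) = 1 := by
    simpa only [A, apply_ite, measure_empty, Finset.sum_ite_mem, Finset.univ_inter] using hsum
  have hmemA : ∀ (ε : Fin n → ℝ) k, ε k ∈ A k ↔ k ∈ S ∧ t ≤ M.ν k + ε k := fun ε k => by
    by_cases hk : k ∈ S <;> simp [A, hk, add_comm]
  have hθ : exclusiveCoupling M.law A ∈ M.couplings :=
    ⟨isProbabilityMeasure_exclusiveCoupling hA hsumA, map_eval_exclusiveCoupling hA hsumA⟩
  have hunique := ae_exclusiveCoupling_existsUnique hA hsumA
  simp only [hmemA] at hunique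
  exact ⟨_, isOptimal_of_ae_existsUnique hθ hS hunique, fun i hi =>
    choiceProb_eq_of_ae_existsUnique hθ hunique hi⟩

end MDM

/-! ### Choice data ranked by levels of the assortments -/

namespace ChoiceData

variable {n : ℕ} {𝒮 : Finset (Finset (Fin n))} {p : ChoiceData 𝒮} {r : {S // S ∈ 𝒮} → ℝ}

/-- Every product is chosen less often from the assortments of higher level `r`, and equally often
from assortments of the same level. -/
def IsRankedBy (p : ChoiceData 𝒮) (r : {S // S ∈ 𝒮} → ℝ) : Prop :=
  ∀ ⦃S T : {S // S ∈ 𝒮}⦄ ⦃i : Fin n⦄ (hS : i ∈ S.1) (hT : i ∈ T.1),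
    r S < r T ↔ p T ⟨i, hT⟩ < p S ⟨i, hS⟩

lemma isRankedBy_iff_of_injective (hr : Function.Injective r) :
    p.IsRankedBy r ↔ ∀ (S T : {S // S ∈ 𝒮}) (i : Fin n) (hS : i ∈ S.1) (hT : i ∈ T.1),
      r S < r T → p T ⟨i, hT⟩ < p S ⟨i, hS⟩ := by
  refine ⟨fun h S T i hS hT => (h hS hT).1, fun h S T i hS hT => ⟨h S T i hS hT, fun hlt => ?_⟩⟩
  by_contra! hle
  rcases hle.lt_or_eq with hTS | hTS
  · exact hlt.not_gt (h T S i hT hS hTS)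
  · obtain rfl := hr hTS
    exact hlt.false

lemma isOpen_setOf_isRankedBy (hr : Function.Injective r) :
    IsOpen {p : ChoiceData 𝒮 | p.IsRankedBy r} := by
  simp only [isRankedBy_iff_of_injective hr, Set.ofPred_forall]
  exact isOpen_iInter_of_finite fun S => isOpen_iInter_of_finite fun T =>
    isOpen_iInter_of_finite fun i => isOpen_iInter_of_finite fun hS =>
    isOpen_iInter_of_finite fun hT => isOpen_iInter_of_finite fun _ =>
    isOpen_lt (by fun_prop) (by fun_prop)

lemma isOpen_setOf_pos : IsOpen {p : ChoiceData 𝒮 | ∀ S i, 0 < p S i} := by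
  simp only [Set.ofPred_forall]
  exact isOpen_iInter_of_finite fun S => isOpen_iInter_of_finite fun i =>
    isOpen_lt (by fun_prop) (by fun_prop)

lemma exists_law_of_isRankedBy (hr : p.IsRankedBy r) (hpos : ∀ S i, 0 < p S i)
    (hΔ : ∀ S, p S ∈ probSimplex S.1) (i : Fin n) :
    ∃ μ a b, IsSpreadOn μ a b ∧ IsProbabilityMeasure μ ∧
      ∀ (S : {S // S ∈ 𝒮}) (hi : i ∈ S.1), μ (Set.Ici (r S)) = ENNReal.ofReal (p S ⟨i, hi⟩) := by
  have hle : ∀ S k, p S k ≤ 1 := fun S k =>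
    (Finset.single_le_sum (fun j _ => (hΔ S).1 j) (Finset.mem_univ k)).trans_eq (hΔ S).2
  obtain ⟨μ, a, b, hspread, hprob, htail⟩ :=
    exists_isSpreadOn_isProbabilityMeasure_measure_Ici_eq
      (x := fun S : {S : {S // S ∈ 𝒮} // i ∈ S.1} => r S.1) (q := fun S => p S.1 ⟨i, S.2⟩)
      (fun S T => hr S.2 T.2) fun S => ⟨hpos S.1 _, hle S.1 _⟩
  exact ⟨μ, a, b, hspread, hprob, fun S hi => htail ⟨S, hi⟩⟩

theorem IsRankedBy.mem_mdmRepresentable (hr : p.IsRankedBy r) (hpos : ∀ S i, 0 < p S i)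
    (hΔ : ∀ S, p S ∈ probSimplex S.1) (h𝒮 : ∀ S ∈ 𝒮, S.Nonempty) :
    p ∈ mdmRepresentable 𝒮 h𝒮 := by
  choose μ a b hspread hprob htail using exists_law_of_isRankedBy hr hpos hΔ
  let M : MDM n :=
    { ν := 0
      law := μ
      isProbabilityMeasure := hprob
      absolutelyContinuous := fun i => (hspread i).absolutelyContinuous
      strictMonoOn_cdf := fun i => (hspread i).strictMonoOn_cdf
      integrable_abs := fun i => (hspread i).integrable_abs }
  have hM : ∀ (S : {S // S ∈ 𝒮}) (i : {i // i ∈ S.1}),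
      M.law i (Set.Ici (r S - M.ν i)) = ENNReal.ofReal (p S i) := fun S i => by
    simpa only [M, Pi.zero_apply, sub_zero] using htail i.1 S i.2
  refine ⟨hΔ, M, fun S => ?_⟩
  have hsum : ∑ i ∈ S.1, M.law i (Set.Ici (r S - M.ν i)) = 1 := by
    rw [← Finset.sum_coe_sort]
    simp only [hM, ← ENNReal.ofReal_sum_of_nonneg fun i _ => (hΔ S).1 i, (hΔ S).2,
      ENNReal.ofReal_one]
  obtain ⟨θ, hopt, hchoice⟩ := M.exists_isOptimal_choiceProb_eq (h𝒮 S.1 S.2) hsum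
  refine ⟨θ, hopt, fun i => ?_⟩
  rw [hchoice i.1 i.2, measureReal_def, hM, ENNReal.toReal_ofReal ((hΔ S).1 i)]

/-- The choice probabilities of the multinomial logit model in which product `i` has weight `w i`
(the exponential of its deterministic utility). -/
noncomputable def logit (𝒮 : Finset (Finset (Fin n))) (w : Fin n → ℝ) : ChoiceData 𝒮 :=
  fun S => WithLp.toLp 2 fun i => w i / ∑ j ∈ S.1, w j

variable {w : Fin n → ℝ}

lemma logit_pos (hw : ∀ i, 0 < w i) (S : {S // S ∈ 𝒮}) (i : {i // i ∈ S.1}) :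
    0 < logit 𝒮 w S i :=
  div_pos (hw i) (Finset.sum_pos (fun j _ => hw j) ⟨i, i.2⟩)

lemma sum_logit (hw : ∀ i, 0 < w i) (S : {S // S ∈ 𝒮}) (hS : S.1.Nonempty) :
    ∑ i, logit 𝒮 w S i = 1 := by
  simp only [logit, ← Finset.sum_div, Finset.sum_coe_sort S.1 w]
  exact div_self (Finset.sum_pos (fun j _ => hw j) hS).ne'

lemma isRankedBy_logit (hw : ∀ i, 0 < w i) :
    (logit 𝒮 w).IsRankedBy fun S => ∑ i ∈ S.1, w i := fun _ _ i hS hT =>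
  (div_lt_div_iff_of_pos_left (hw i) (Finset.sum_pos (fun j _ => hw j) ⟨i, hT⟩)
    (Finset.sum_pos (fun j _ => hw j) ⟨i, hS⟩)).symm

end ChoiceData

lemma sum_two_pow_injective (n : ℕ) :
    Function.Injective fun S : Finset (Fin n) => ∑ i ∈ S, (2 : ℝ) ^ (i : ℕ) := by
  intro S T h
  have hnat : ∑ i ∈ S, 2 ^ (i : ℕ) = ∑ i ∈ T, 2 ^ (i : ℕ) := by
    beta_reduce at h
    exact_mod_cast h
  refine Finset.map_injective Fin.valEmbedding (Finset.geomSum_injective le_rfl ?_)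
  simpa using hnat

/-! ### Lebesgue measure on products of simplices -/

section Simplex

variable {n : ℕ} {S : Finset (Fin n)}

lemma sum_barycenter (hS : S.Nonempty) : ∑ i, barycenter S i = 1 := by
  simp [barycenter, hS.ne_empty]

lemma mem_sumZero {v : EuclideanSpace ℝ {i // i ∈ S}} : v ∈ sumZero S ↔ ∑ i, v i = 0 :=
  Iff.rfl

lemma sub_barycenter_mem_sumZero_iff (hS : S.Nonempty) {x : EuclideanSpace ℝ {i // i ∈ S}} :
    x - barycenter S ∈ sumZero S ↔ ∑ i, x i = 1 := by
  simp only [mem_sumZero, PiLp.sub_apply, Finset.sum_sub_distrib, sum_barycenter hS, sub_eq_zero]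

lemma isClosed_probSimplex (S : Finset (Fin n)) : IsClosed (probSimplex S) := by
  simp only [probSimplex, Set.ofPred_and, Set.ofPred_forall]
  exact (isClosed_iInter fun i => isClosed_le (by fun_prop) (by fun_prop)).inter
    (isClosed_eq (by fun_prop) (by fun_prop))

instance sigmaFinite_simplexMeasure (S : Finset (Fin n)) : SigmaFinite (simplexMeasure S) := by
  have hemb : MeasurableEmbedding (fun v : sumZero S => barycenter S + v.1) :=
    ((Homeomorph.addLeft (barycenter S)).isClosedEmbedding.comp
      (sumZero S).closed_of_finiteDimensional.isClosedEmbedding_subtypeVal).measurableEmbedding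
  have := hemb.sigmaFinite_map (μ := (stdOrthonormalBasis ℝ (sumZero S)).toBasis.addHaar)
  unfold simplexMeasure
  infer_instance

lemma simplexMeasure_inter_probSimplex_pos {U : Set (EuclideanSpace ℝ {i // i ∈ S})}
    (hU : IsOpen U) {x : EuclideanSpace ℝ {i // i ∈ S}} (hxU : x ∈ U) (hpos : ∀ i, 0 < x i)
    (hsum : ∑ i, x i = 1) : 0 < simplexMeasure S (U ∩ probSimplex S) := by
  have hS : S.Nonempty := by
    obtain ⟨i, -, -⟩ := Finset.exists_ne_zero_of_sum_ne_zero (hsum.trans_ne one_ne_zero)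
    exact ⟨i, i.2⟩
  let f : sumZero S → EuclideanSpace ℝ {i // i ∈ S} := fun v => barycenter S + v
  have hf : Continuous f := by fun_prop
  let V : Set (sumZero S) := f ⁻¹' (U ∩ ⋂ i, {y | 0 < y i})
  have hVopen : IsOpen V :=
    (hU.inter (isOpen_iInter_of_finite fun i => isOpen_lt (by fun_prop) (by fun_prop))).preimage hf
  have hVne : V.Nonempty :=
    ⟨⟨x - barycenter S, (sub_barycenter_mem_sumZero_iff hS).2 hsum⟩, by simp [V, f, hxU, hpos]⟩
  have hVsub : V ⊆ f ⁻¹' (U ∩ probSimplex S ∩ probSimplex S) := by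
    rintro v ⟨hvU, hvpos⟩
    have hvΔ : f v ∈ probSimplex S :=
      ⟨fun i => (Set.mem_iInter.1 hvpos i).le,
        (sub_barycenter_mem_sumZero_iff hS).1 (by simp [f])⟩
    exact ⟨⟨hvU, hvΔ⟩, hvΔ⟩
  calc 0 < (stdOrthonormalBasis ℝ (sumZero S)).toBasis.addHaar V := hVopen.measure_pos _ hVne
    _ ≤ (stdOrthonormalBasis ℝ (sumZero S)).toBasis.addHaar
          (f ⁻¹' (U ∩ probSimplex S ∩ probSimplex S)) := measure_mono hVsub
    _ ≤ _ := Measure.le_map_apply hf.measurable.aemeasurable _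
    _ ≤ simplexMeasure S (U ∩ probSimplex S) := Measure.le_restrict_apply _ _

theorem simplexProdMeasure_inter_pi_probSimplex_pos {𝒮 : Finset (Finset (Fin n))}
    {D : Set (ChoiceData 𝒮)} (hD : IsOpen D) {p : ChoiceData 𝒮} (hpD : p ∈ D)
    (hpos : ∀ S i, 0 < p S i) (hsum : ∀ S, ∑ i, p S i = 1) :
    0 < simplexProdMeasure 𝒮 (D ∩ Set.univ.pi fun S => probSimplex S.1) := by
  obtain ⟨u, hu, huD⟩ := isOpen_pi_iff'.1 hD p hpD
  have hbox : (Set.univ.pi fun S => u S ∩ probSimplex S.1) ⊆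
      D ∩ Set.univ.pi fun S => probSimplex S.1 := by
    rw [Set.pi_inter_distrib]
    exact Set.inter_subset_inter_left _ huD
  refine lt_of_lt_of_le ?_ (measure_mono hbox)
  rw [simplexProdMeasure, Measure.pi_pi]
  exact CanonicallyOrderedAdd.prod_pos.2 fun S _ =>
    simplexMeasure_inter_probSimplex_pos (hu S).1 (hu S).2 (hpos S) (hsum S)

end Simplex

theorem theorem2 (n : ℕ) (𝒮 : Finset (Finset (Fin n))) (h𝒮 : ∀ S ∈ 𝒮, S.Nonempty) :
    0 < simplexProdMeasure 𝒮 (mdmRepresentable 𝒮 h𝒮) ∧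
      ∃ A ⊆ mdmRepresentable 𝒮 h𝒮, MeasurableSet A ∧ 0 < simplexProdMeasure 𝒮 A := by
  let w : Fin n → ℝ := fun i => 2 ^ (i : ℕ)
  let r : {S // S ∈ 𝒮} → ℝ := fun S => ∑ i ∈ S.1, w i
  have hw : ∀ i, 0 < w i := fun i => by positivity
  have hr : Function.Injective r := (sum_two_pow_injective n).comp Subtype.val_injective
  let D : Set (ChoiceData 𝒮) := {p | ∀ S i, 0 < p S i} ∩ {p | p.IsRankedBy r}
  let A : Set (ChoiceData 𝒮) := D ∩ Set.univ.pi fun S => probSimplex S.1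
  have hD : IsOpen D := ChoiceData.isOpen_setOf_pos.inter (ChoiceData.isOpen_setOf_isRankedBy hr)
  have hlogit : ChoiceData.logit 𝒮 w ∈ D :=
    ⟨ChoiceData.logit_pos hw, ChoiceData.isRankedBy_logit hw⟩
  have hA : A ⊆ mdmRepresentable 𝒮 h𝒮 := fun p hp =>
    hp.1.2.mem_mdmRepresentable hp.1.1 (fun S => hp.2 S trivial) h𝒮
  have hmeas : MeasurableSet A := hD.measurableSet.inter
    (isClosed_set_pi fun S _ => isClosed_probSimplex S.1).measurableSet
  have hpos : 0 < simplexProdMeasure 𝒮 A := simplexProdMeasure_inter_pi_probSimplex_pos hD hlogit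
    hlogit.1 fun S => ChoiceData.sum_logit hw S (h𝒮 S.1 S.2)
  exact ⟨hpos.trans_le (measure_mono hA), A, hA, hmeas, hpos⟩
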